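/- Let $\phi:[0,\infty)\to[0,\infty)$ be a continuously differentiable function with $\lim_{r\to\infty} r\phi'(r)=\infty$, and let $1\le p,q\le\infty$. For an entire function $f$ and $r\ge 0$ put $$M_p(f,r)=\Big(\frac1{2\pi}\int_0^{2\pi}|f(re^{i\theta})|^p\,d\theta\Big)^{1/p}\ (p<\infty),\qquad M_\infty(f,r)=\sup_{\theta}|f(re^{i\theta})|,$$ $$\|f\|_{p,q,\phi}=\Big(\int_0^\infty M_p(f,r)^q e^{-q\phi(r)}\,r\,dr\Big)^{1/q}\ (q<\infty),\qquad \|f\|_{p,\infty,\phi}=\sup_{r\ge 0}M_p(f,r)e^{-\phi(r)},$$ and let $F_\phi^{p,q}$ be the normed space of all entire functions $f$ with $\|f\|_{p,q,\phi}<\infty$. Assume that $\lim_{n\to\infty}\|z^n\|_{p,q,\phi}^{1/n}=\infty$. Let $\mu$ be a positive Borel measure on $(0,\infty)$, and consider the Hausdorff operator $$\mathcal H_\mu f(z)=\int_{(0,\infty)}\frac1t\,f\Big(\frac zt\Big)\,d\mu(t),\qquad z\in\mathbb C .$$ Then $\mathcal H_\mu$ is a compact operator on $F_\phi^{p,q}$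 (that is, the integral converges absolutely for every $f\in F_\phi^{p,q}$ and every $z\in\mathbb C$, and $f\mapsto\mathcal H_\mu f$ is a compact linear operator from $F_\phi^{p,q}$ to itself) if and only if $$\mu((0,1])=0\quad\text{and}\quad\int_{(0,\infty)}\frac1t\,d\mu(t)<\infty .$$ -/

import Mathlib

open Set Filter Topology MeasureTheory
open scoped ENNReal

namespace HausdorffFock

/-- A continuously differentiable function `φ : [0, ∞) → [0, ∞)`. It is extended radially to the
plane by `φ(z) = φ(|z|)`; the weight carried by the function spaces below is `exp (-φ(|z|))`.
Only the values on `[0, ∞)` are ever used. -/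
structure RadialWeight where
  toFun : ℝ → ℝ
  nonneg : ∀ r, 0 ≤ r → 0 ≤ toFun r
  contDiffOn : ContDiffOn ℝ 1 toFun (Ici 0)

instance : CoeFun RadialWeight (fun _ => ℝ → ℝ) := ⟨RadialWeight.toFun⟩

/-- The class `𝒞`: `r φ'(r) → ∞` as `r → ∞`. -/
def RadialWeight.InClassC (φ : RadialWeight) : Prop :=
  Tendsto (fun r : ℝ => r * deriv φ r) atTop atTop

/-- The integral mean `M_p(f, r)`, as an extended nonnegative number:
`((2π)⁻¹ ∫_0^{2π} |f(r e^{iθ})|^p dθ)^{1/p}`, and `sup_θ |f(r e^{iθ})|` for `p = ∞`.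
Here `circleMap 0 r θ = r e^{iθ}`. -/
noncomputable def circleMean (p : ℝ≥0∞) (f : ℂ → ℂ) (r : ℝ) : ℝ≥0∞ :=
  if p = ∞ then ⨆ θ : ℝ, ‖f (circleMap 0 r θ)‖ₑ
  else (ENNReal.ofReal (1 / (2 * Real.pi)) *
    ∫⁻ θ in Ioc 0 (2 * Real.pi), ‖f (circleMap 0 r θ)‖ₑ ^ p.toReal) ^ (1 / p.toReal)

/-- The mixed norm `‖f‖_{p,q,φ}`, as an extended nonnegative number:
`(∫_0^∞ M_p(f, r)^q e^{-qφ(r)} r dr)^{1/q}`, and `sup_{r ≥ 0} M_p(f, r) e^{-φ(r)}` for `q = ∞`. -/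
noncomputable def mixedNorm (p q : ℝ≥0∞) (φ : RadialWeight) (f : ℂ → ℂ) : ℝ≥0∞ :=
  if q = ∞ then ⨆ r : Ici (0 : ℝ), circleMean p f r * ENNReal.ofReal (Real.exp (-φ r))
  else (∫⁻ r in Ioi (0 : ℝ), circleMean p f r ^ q.toReal *
    ENNReal.ofReal (Real.exp (-(q.toReal * φ r)) * r)) ^ (1 / q.toReal)

section Facts

theorem one_le_toReal {p : ℝ≥0∞} (hp : 1 ≤ p) (h : p ≠ ∞) : 1 ≤ p.toReal := by
  have := ENNReal.toReal_mono h hp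
  simpa using this

theorem measurable_circleMean (p : ℝ≥0∞) {f : ℂ → ℂ} (hf : Continuous f) :
    Measurable (circleMean p f) := by
  by_cases h : p = ∞
  · have : circleMean p f = fun r => ⨆ θ : ℝ, ‖f (circleMap 0 r θ)‖ₑ := by
      funext r; simp [circleMean, h]
    rw [this]
    refine (lowerSemicontinuous_iSup fun θ => Continuous.lowerSemicontinuous ?_).measurable
    unfold circleMap; fun_prop
  · have : circleMean p f = fun r => (ENNReal.ofReal (1 / (2 * Real.pi)) *
        ∫⁻ θ in Ioc 0 (2 * Real.pi), ‖f (circleMap 0 r θ)‖ₑ ^ p.toReal) ^ (1 / p.toReal) := by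
      funext r; simp [circleMean, h]
    rw [this]
    refine Measurable.pow_const (Measurable.const_mul (Measurable.lintegral_prod_right ?_) _) _
    refine Measurable.pow_const ?_ _
    apply Continuous.measurable
    change Continuous fun x : ℝ × ℝ => ‖f (circleMap 0 x.1 x.2)‖ₑ
    unfold circleMap; fun_prop

theorem circleMean_zero {p : ℝ≥0∞} (hp : 1 ≤ p) (r : ℝ) : circleMean p 0 r = 0 := by
  by_cases h : p = ∞
  · simp [circleMean, h]
  · have := one_le_toReal hp h
    have h0 : 0 < p.toReal := by linarith
    simp [circleMean, h, h0]

theorem circleMean_add_le {p : ℝ≥0∞} (hp : 1 ≤ p) {f g : ℂ → ℂ} (hf : Continuous f)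
    (hg : Continuous g) (r : ℝ) :
    circleMean p (f + g) r ≤ circleMean p f r + circleMean p g r := by
  by_cases h : p = ∞
  · simp only [circleMean, h, if_true]
    refine iSup_le fun θ => (enorm_add_le _ _).trans ?_
    exact add_le_add (le_iSup (fun θ : ℝ => ‖f (circleMap 0 r θ)‖ₑ) θ)
      (le_iSup (fun θ : ℝ => ‖g (circleMap 0 r θ)‖ₑ) θ)
  · have h1 := one_le_toReal hp h
    simp only [circleMean, h, if_false]
    have key (u : ℝ → ℝ≥0∞) : ENNReal.ofReal (1 / (2 * Real.pi)) *
        ∫⁻ θ in Ioc 0 (2 * Real.pi), u θ =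
        ∫⁻ θ, u θ ∂(ENNReal.ofReal (1 / (2 * Real.pi)) •
          (volume.restrict (Ioc 0 (2 * Real.pi)))) := by
      rw [lintegral_smul_measure, smul_eq_mul]
    simp only [key]
    have mf : Measurable fun θ : ℝ => ‖f (circleMap 0 r θ)‖ₑ := by
      apply Continuous.measurable; unfold circleMap; fun_prop
    have mg : Measurable fun θ : ℝ => ‖g (circleMap 0 r θ)‖ₑ := by
      apply Continuous.measurable; unfold circleMap; fun_prop
    refine le_trans ?_ (ENNReal.lintegral_Lp_add_le mf.aemeasurable mg.aemeasurable h1)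
    gcongr with θ
    exact enorm_add_le _ _

theorem circleMean_smul {p : ℝ≥0∞} (hp : 1 ≤ p) (c : ℂ) (f : ℂ → ℂ) (r : ℝ) :
    circleMean p (c • f) r = ‖c‖ₑ * circleMean p f r := by
  by_cases h : p = ∞
  · simp [circleMean, h, enorm_mul, ENNReal.mul_iSup]
  · have h1 := one_le_toReal hp h
    have h0 : 0 < p.toReal := by linarith
    simp only [circleMean, h, if_false, Pi.smul_apply, smul_eq_mul, enorm_mul,
      ENNReal.mul_rpow_of_nonneg _ _ h0.le]
    rw [lintegral_const_mul' _ _ (by finiteness), mul_left_comm,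
      ENNReal.mul_rpow_of_nonneg _ _ (by positivity), ← ENNReal.rpow_mul,
      mul_one_div_cancel h0.ne', ENNReal.rpow_one,
      ENNReal.mul_rpow_of_nonneg _ _ (by positivity)]

theorem mixedNorm_zero {p q : ℝ≥0∞} (hp : 1 ≤ p) (hq : 1 ≤ q) (φ : RadialWeight) :
    mixedNorm p q φ 0 = 0 := by
  by_cases h : q = ∞
  · simp [mixedNorm, h, circleMean_zero hp]
  · have := one_le_toReal hq h
    have h0 : 0 < q.toReal := by linarith
    simp [mixedNorm, h, h0, circleMean_zero hp]

theorem mixedNorm_add_le {p q : ℝ≥0∞} (hp : 1 ≤ p) (hq : 1 ≤ q) (φ : RadialWeight)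
    {f g : ℂ → ℂ} (hf : Continuous f) (hg : Continuous g) :
    mixedNorm p q φ (f + g) ≤ mixedNorm p q φ f + mixedNorm p q φ g := by
  by_cases h : q = ∞
  · simp only [mixedNorm, h, if_true]
    refine iSup_le fun r => ?_
    refine (mul_le_mul_left (circleMean_add_le hp hf hg r) _).trans ?_
    rw [add_mul]
    exact add_le_add
      (le_iSup (fun r : Ici (0 : ℝ) => circleMean p f r * ENNReal.ofReal (Real.exp (-φ r))) r)
      (le_iSup (fun r : Ici (0 : ℝ) => circleMean p g r * ENNReal.ofReal (Real.exp (-φ r))) r)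
  · have h1 := one_le_toReal hq h
    have h0 : 0 < q.toReal := by linarith
    have hρ : AEMeasurable (fun r : ℝ => ENNReal.ofReal (Real.exp (-(q.toReal * φ r)) * r))
        (volume.restrict (Ioi 0)) := by
      refine AEMeasurable.ennreal_ofReal (ContinuousOn.aemeasurable ?_ measurableSet_Ioi)
      have := φ.contDiffOn.continuousOn.mono Ioi_subset_Ici_self
      fun_prop
    have key (u : ℂ → ℂ) (hu : Continuous u) :
        ∫⁻ r in Ioi (0 : ℝ), circleMean p u r ^ q.toReal *
          ENNReal.ofReal (Real.exp (-(q.toReal * φ r)) * r) =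
        ∫⁻ r, circleMean p u r ^ q.toReal ∂((volume.restrict (Ioi 0)).withDensity
          fun r : ℝ => ENNReal.ofReal (Real.exp (-(q.toReal * φ r)) * r)) := by
      rw [lintegral_withDensity_eq_lintegral_mul₀ hρ
        ((measurable_circleMean p hu).pow_const _).aemeasurable]
      simp only [Pi.mul_apply, mul_comm]
    simp only [mixedNorm, h, if_false]
    rw [key _ (hf.add hg), key _ hf, key _ hg]
    refine le_trans ?_ (ENNReal.lintegral_Lp_add_le (measurable_circleMean p hf).aemeasurable
      (measurable_circleMean p hg).aemeasurable h1)
    gcongr with r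
    exact circleMean_add_le hp hf hg r

theorem mixedNorm_smul {p q : ℝ≥0∞} (hp : 1 ≤ p) (hq : 1 ≤ q) (φ : RadialWeight) (c : ℂ)
    (f : ℂ → ℂ) : mixedNorm p q φ (c • f) = ‖c‖ₑ * mixedNorm p q φ f := by
  by_cases h : q = ∞
  · simp [mixedNorm, h, circleMean_smul hp, ENNReal.mul_iSup, mul_assoc]
  · have h1 := one_le_toReal hq h
    have h0 : 0 < q.toReal := by linarith
    simp only [mixedNorm, h, if_false, circleMean_smul hp,
      ENNReal.mul_rpow_of_nonneg _ _ h0.le, mul_assoc]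
    rw [lintegral_const_mul' _ _ (by finiteness),
      ENNReal.mul_rpow_of_nonneg _ _ (by positivity), ← ENNReal.rpow_mul,
      mul_one_div_cancel h0.ne', ENNReal.rpow_one]

theorem eq_zero_of_circleMean {p : ℝ≥0∞} (hp : 1 ≤ p) {f : ℂ → ℂ} (hf : Differentiable ℂ f)
    {r : ℝ} (hr : 0 < r) (h : circleMean p f r = 0) : f = 0 := by
  have hz : ∀ θ ∈ Ioo 0 (2 * Real.pi), f (circleMap 0 r θ) = 0 := by
    by_cases hp' : p = ∞
    · simp only [circleMean, hp', if_true, ENNReal.iSup_eq_zero, enorm_eq_zero] at h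
      exact fun θ _ => h θ
    · have h1 := one_le_toReal hp hp'
      have h0 : 0 < p.toReal := by linarith
      simp only [circleMean, hp', if_false] at h
      rw [ENNReal.rpow_eq_zero_iff_of_pos (by positivity), mul_eq_zero] at h
      have hc : Continuous fun θ : ℝ => f (circleMap 0 r θ) :=
        hf.continuous.comp (continuous_circleMap 0 r)
      rcases h with h | h
      · rw [ENNReal.ofReal_eq_zero] at h
        exact absurd h (not_le.mpr (by positivity))
      · rw [lintegral_eq_zero_iff (hc.enorm.measurable.pow_const _)] at h
        have h' : (fun θ : ℝ => f (circleMap 0 r θ))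
            =ᵐ[volume.restrict (Ioo 0 (2 * Real.pi))] fun _ => 0 := by
          filter_upwards [ae_restrict_of_ae_restrict_of_subset Ioo_subset_Ioc_self h] with θ hθ
          simpa [h0, h0.ne', ENNReal.rpow_eq_zero_iff, h0.not_gt] using hθ
        exact Measure.eqOn_open_of_ae_eq h' isOpen_Ioo hc.continuousOn continuousOn_const
  have hA : AnalyticOnNhd ℂ f univ := hf.differentiableOn.analyticOnNhd isOpen_univ
  refine AnalyticOnNhd.eq_of_frequently_eq (z₀ := circleMap 0 r Real.pi) hA
    analyticOnNhd_const ?_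
  have hd : HasDerivAt (circleMap 0 r) (circleMap 0 r Real.pi * Complex.I) Real.pi :=
    hasDerivAt_circleMap 0 r Real.pi
  have ht : Tendsto (circleMap 0 r) (𝓝[≠] Real.pi) (𝓝[≠] (circleMap 0 r Real.pi)) :=
    hd.tendsto_nhdsNE (by simp [hr.ne'])
  refine ht.frequently (Eventually.frequently ?_)
  have : ∀ᶠ θ in 𝓝 Real.pi, θ ∈ Ioo 0 (2 * Real.pi) :=
    Ioo_mem_nhds Real.pi_pos (by linarith [Real.pi_pos])
  filter_upwards [nhdsWithin_le_nhds this] with θ hθ using hz θ hθ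

theorem eq_zero_of_mixedNorm {p q : ℝ≥0∞} (hp : 1 ≤ p) (hq : 1 ≤ q) (φ : RadialWeight)
    {f : ℂ → ℂ} (hf : Differentiable ℂ f) (h : mixedNorm p q φ f = 0) : f = 0 := by
  by_cases hq' : q = ∞
  · simp only [mixedNorm, hq', if_true, ENNReal.iSup_eq_zero] at h
    have := h ⟨1, by simp⟩
    rw [mul_eq_zero, ENNReal.ofReal_eq_zero] at this
    exact eq_zero_of_circleMean hp hf one_pos
      (this.resolve_right (not_le.mpr (Real.exp_pos _)))
  · have h1 := one_le_toReal hq hq'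
    have h0 : 0 < q.toReal := by linarith
    simp only [mixedNorm, hq', if_false] at h
    rw [ENNReal.rpow_eq_zero_iff_of_pos (by positivity), lintegral_eq_zero_iff'] at h
    · have hne : (ae (volume.restrict (Ioi (0 : ℝ)))).NeBot := by
        rw [ae_neBot, Ne, Measure.restrict_eq_zero]; simp
      obtain ⟨r, hr, hr0⟩ := (h.and (ae_restrict_mem measurableSet_Ioi)).exists
      have hr0 : 0 < r := hr0
      simp only [Pi.zero_apply, mul_eq_zero, ENNReal.ofReal_eq_zero] at hr
      have := hr.resolve_right (not_le.mpr (by positivity))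
      rw [ENNReal.rpow_eq_zero_iff_of_pos h0] at this
      exact eq_zero_of_circleMean hp hf hr0 this
    · refine ((measurable_circleMean p hf.continuous).pow_const _).aemeasurable.mul ?_
      refine AEMeasurable.ennreal_ofReal (ContinuousOn.aemeasurable ?_ measurableSet_Ioi)
      have := φ.contDiffOn.continuousOn.mono Ioi_subset_Ici_self
      fun_prop

end Facts

/-- The entire functions `f` with `‖f‖_{p,q,φ} < ∞`, as a linear subspace of all functions. -/
noncomputable def fockSubmodule (p q : ℝ≥0∞) [hp : Fact (1 ≤ p)] [hq : Fact (1 ≤ q)]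
    (φ : RadialWeight) : Submodule ℂ (ℂ → ℂ) where
  carrier := {f | Differentiable ℂ f ∧ mixedNorm p q φ f < ∞}
  zero_mem' := ⟨differentiable_const 0, by simp [mixedNorm_zero hp.out hq.out]⟩
  add_mem' := fun {f g} hf hg => ⟨hf.1.add hg.1,
    (mixedNorm_add_le hp.out hq.out φ hf.1.continuous hg.1.continuous).trans_lt
      (ENNReal.add_lt_top.mpr ⟨hf.2, hg.2⟩)⟩
  smul_mem' := fun c f hf => ⟨hf.1.const_smul c, by
    rw [mixedNorm_smul hp.out hq.out]
    exact ENNReal.mul_lt_top (by finiteness) hf.2⟩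

/-- The weighted mixed norm Fock space `F_φ^{p,q}`, `1 ≤ p, q ≤ ∞`. (Not reducible, so that its
only topology is the one of the norm below, and not the one of pointwise convergence.) -/
def FockSpace (p q : ℝ≥0∞) [Fact (1 ≤ p)] [Fact (1 ≤ q)] (φ : RadialWeight) : Type :=
  ↥(fockSubmodule p q φ)

namespace FockSpace

variable {p q : ℝ≥0∞} [hp : Fact (1 ≤ p)] [hq : Fact (1 ≤ q)] {φ : RadialWeight}

noncomputable instance : AddCommGroup (FockSpace p q φ) :=
  inferInstanceAs (AddCommGroup ↥(fockSubmodule p q φ))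

noncomputable instance : Module ℂ (FockSpace p q φ) :=
  inferInstanceAs (Module ℂ ↥(fockSubmodule p q φ))

/-- The entire function underlying an element of the Fock space. -/
def toFun (f : FockSpace p q φ) : ℂ → ℂ := f.1

instance : CoeFun (FockSpace p q φ) (fun _ => ℂ → ℂ) := ⟨toFun⟩

noncomputable instance : Norm (FockSpace p q φ) := ⟨fun f => (mixedNorm p q φ f).toReal⟩

theorem core : NormedSpace.Core ℂ (FockSpace p q φ) where
  norm_nonneg _ := ENNReal.toReal_nonneg
  norm_smul c f := by
    change (mixedNorm p q φ (c • f.1)).toReal = ‖c‖ * (mixedNorm p q φ f.1).toReal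
    rw [mixedNorm_smul hp.out hq.out, ENNReal.toReal_mul, toReal_enorm]
  norm_triangle f g := by
    change (mixedNorm p q φ (f.1 + g.1)).toReal ≤
      (mixedNorm p q φ f.1).toReal + (mixedNorm p q φ g.1).toReal
    rw [← ENNReal.toReal_add f.2.2.ne g.2.2.ne]
    exact ENNReal.toReal_mono (ENNReal.add_lt_top.mpr ⟨f.2.2, g.2.2⟩).ne
      (mixedNorm_add_le hp.out hq.out φ f.2.1.continuous g.2.1.continuous)
  norm_eq_zero_iff f := by
    change (mixedNorm p q φ f.1).toReal = 0 ↔ f = 0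
    constructor
    · intro h
      refine Subtype.ext (eq_zero_of_mixedNorm hp.out hq.out φ f.2.1 ?_)
      exact ((ENNReal.toReal_eq_zero_iff _).mp h).resolve_right f.2.2.ne
    · rintro rfl
      change (mixedNorm p q φ 0).toReal = 0
      simp [mixedNorm_zero hp.out hq.out]

noncomputable instance : NormedAddCommGroup (FockSpace p q φ) :=
  NormedAddCommGroup.ofCore (𝕜 := ℂ) core

noncomputable instance : NormedSpace ℂ (FockSpace p q φ) := NormedSpace.ofCore core

end FockSpace

/-- The integrand `t ↦ t⁻¹ f(z / t)`, `t ∈ (0, ∞)`, of the Hausdorff operator at `z`. -/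
noncomputable def hausdorffKernel (f : ℂ → ℂ) (z : ℂ) (t : Ioi (0 : ℝ)) : ℂ :=
  (1 / (t : ℂ)) * f (z / (t : ℂ))

/-- The operator `T` on `F_φ^{p,q}` is the Hausdorff operator `H_μ`: for every `f` in the space and
every `z`, the defining integral converges (absolutely) and `T f (z) = ∫ t⁻¹ f(z / t) dμ(t)`. -/
def IsHausdorffOperator {p q : ℝ≥0∞} [Fact (1 ≤ p)] [Fact (1 ≤ q)] {φ : RadialWeight}
    (μ : Measure (Ioi (0 : ℝ))) (T : FockSpace p q φ →L[ℂ] FockSpace p q φ) : Prop :=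
  ∀ (f : FockSpace p q φ) (z : ℂ),
    Integrable (hausdorffKernel f z) μ ∧ T f z = ∫ t, hausdorffKernel f z t ∂μ

end HausdorffFock

/-!
The Hausdorff operator is an average of dilations, `H_μ = ∫ t⁻¹ D_{1/t} dμ(t)` with
`D_s f(z) = f(sz)`, and both directions are read off from the way `D_s` acts on power series.

The rank one operators `R_n f = a_n z^n` (`FockSpace.term`), where `f = ∑ a_n z^n`, have norm at
most one: by Cauchy's formula `|a_n| r^n ≤ M_p(f, r)` for every `r`
(`circleMean_taylorCoeff_le`). With `‖z^n‖^{1/n} → ∞` this makes point evaluations locally uniformly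
bounded, as `|f(z)| ≤ ‖f‖ ∑ |z|^n / ‖z^n‖` (`FockSpace.norm_apply_le`), and Fatou's lemma then gives
completeness of the space (`FockSpace.completeSpace`).

Sufficiency. For `0 ≤ s < 1` the series `D_s = ∑ s^n R_n` converges in operator norm, so `D_s` is
compact; no normal families argument is needed. Since `M_p(f, r)` increases with `r`
(`circleMean_dilation_le`, from the Poisson formula and Jensen's inequality), `‖D_s‖ ≤ 1`. If `μ`
is carried by `(1, ∞)` and `1 / t` is integrable, `∫ t⁻¹ D_{1/t} dμ(t)` is therefore a convergent
Bochner integral in the space of bounded operators. Its value is compact because the compact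
operators form a closed subspace, and it is `H_μ` because point evaluations commute with the
integral.

Necessity. The integral for `f = 1`, `z = 0` is `∫ t⁻¹ dμ`. Each monomial is an eigenvector:
`H_μ z^n = c_n z^n` with `μ((0, 1]) ≤ c_n = ∫ t^{-n-1} dμ ≤ ‖H_μ‖`. The functions
`H_μ (z^n / ‖z^n‖)` tend to zero at every point, hence so does every norm cluster point of theirs,
and by compactness there is one; but their norms are `c_n ≥ μ((0, 1])`. So `μ((0, 1]) = 0`.
-/

namespace HausdorffFock

/-! ### The integral means `M_p` -/

/-- The normalized arc length measure `dθ / 2π` on the parameter interval `(0, 2π]`. -/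
noncomputable def arcMeasure : Measure ℝ :=
  ENNReal.ofReal (1 / (2 * Real.pi)) • volume.restrict (Ioc 0 (2 * Real.pi))

instance : IsProbabilityMeasure arcMeasure := by
  constructor
  simp only [arcMeasure, Measure.smul_apply, Measure.restrict_apply_univ, Real.volume_Ioc,
    sub_zero, smul_eq_mul]
  rw [← ENNReal.ofReal_mul (by positivity), one_div_mul_cancel (by positivity), ENNReal.ofReal_one]

theorem lintegral_arcMeasure (u : ℝ → ℝ≥0∞) :
    ∫⁻ θ, u θ ∂arcMeasure =
      ENNReal.ofReal (1 / (2 * Real.pi)) * ∫⁻ θ in Ioc 0 (2 * Real.pi), u θ := by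
  rw [arcMeasure, lintegral_smul_measure, smul_eq_mul]

theorem circleAverage_eq_integral_arcMeasure {E : Type*} [NormedAddCommGroup E] [NormedSpace ℝ E]
    (f : ℂ → E) (c : ℂ) (r : ℝ) :
    Real.circleAverage f c r = ∫ θ, f (circleMap c r θ) ∂arcMeasure := by
  rw [Real.circleAverage_def, arcMeasure, integral_smul_measure,
    intervalIntegral.integral_of_le (by positivity), ENNReal.toReal_ofReal (by positivity),
    one_div]

theorem circleMean_eq_rpow {p : ℝ≥0∞} (hp : p ≠ ∞) (f : ℂ → ℂ) (r : ℝ) :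
    circleMean p f r =
      (∫⁻ θ, ‖f (circleMap 0 r θ)‖ₑ ^ p.toReal ∂arcMeasure) ^ (1 / p.toReal) := by
  rw [circleMean, if_neg hp, lintegral_arcMeasure]

theorem circleMean_top (f : ℂ → ℂ) (r : ℝ) :
    circleMean ∞ f r = ⨆ θ : ℝ, ‖f (circleMap 0 r θ)‖ₑ := by
  simp [circleMean]

theorem circleMean_mono (p : ℝ≥0∞) {f g : ℂ → ℂ} {r s : ℝ}
    (h : ∀ θ, ‖f (circleMap 0 r θ)‖ₑ ≤ ‖g (circleMap 0 s θ)‖ₑ) :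
    circleMean p f r ≤ circleMean p g s := by
  by_cases hp : p = ∞
  · subst hp
    simp only [circleMean_top]
    exact iSup_mono h
  · simp only [circleMean_eq_rpow hp]
    gcongr with θ
    exact h θ

theorem circleMean_of_enorm_eq {p : ℝ≥0∞} (hp : 1 ≤ p) {f : ℂ → ℂ} {r : ℝ} {C : ℝ≥0∞}
    (h : ∀ θ, ‖f (circleMap 0 r θ)‖ₑ = C) : circleMean p f r = C := by
  by_cases hp' : p = ∞
  · subst hp'
    simp [circleMean_top, h]
  · have h0 : 0 < p.toReal := zero_lt_one.trans_le (one_le_toReal hp hp')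
    simp only [circleMean_eq_rpow hp', h, lintegral_const, measure_univ, mul_one]
    rw [← ENNReal.rpow_mul, mul_one_div_cancel h0.ne', ENNReal.rpow_one]

theorem circleMean_const {p : ℝ≥0∞} (hp : 1 ≤ p) (c : ℂ) (r : ℝ) :
    circleMean p (fun _ => c) r = ‖c‖ₑ :=
  circleMean_of_enorm_eq hp fun _ => rfl

theorem circleMean_pow {p : ℝ≥0∞} (hp : 1 ≤ p) (n : ℕ) {r : ℝ} (hr : 0 ≤ r) :
    circleMean p (fun z => z ^ n) r = ENNReal.ofReal (r ^ n) := by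
  refine circleMean_of_enorm_eq hp fun θ => ?_
  rw [← ofReal_norm, norm_pow, norm_circleMap_zero, abs_of_nonneg hr]

theorem circleMean_le_add {p : ℝ≥0∞} (hp : 1 ≤ p) {f g : ℂ → ℂ} (hf : Continuous f)
    (hg : Continuous g) {r ε : ℝ}
    (h : ∀ θ, ‖f (circleMap 0 r θ) - g (circleMap 0 r θ)‖ ≤ ε) :
    circleMean p f r ≤ circleMean p g r + ENNReal.ofReal ε := by
  have hε : 0 ≤ ε := (norm_nonneg _).trans (h 0)
  have h1 := circleMean_add_le hp hg (hf.sub hg) r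
  rw [add_sub_cancel] at h1
  refine h1.trans (add_le_add_right ?_ _)
  calc circleMean p (f - g) r ≤ circleMean p (fun _ => (ε : ℂ)) r := circleMean_mono p fun θ => by
        rw [enorm_le_iff_norm_le, Complex.norm_real, Real.norm_of_nonneg hε]
        exact h θ
    _ = ENNReal.ofReal ε := by
        rw [circleMean_const hp, ← ofReal_norm, Complex.norm_real, Real.norm_of_nonneg hε]

theorem lintegral_enorm_le_circleMean {p : ℝ≥0∞} (hp : 1 ≤ p) {f : ℂ → ℂ} (hf : Continuous f)
    (r : ℝ) : ∫⁻ θ, ‖f (circleMap 0 r θ)‖ₑ ∂arcMeasure ≤ circleMean p f r := by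
  have hc : Continuous fun θ : ℝ => f (circleMap 0 r θ) := hf.comp (continuous_circleMap 0 r)
  by_cases hp' : p = ∞
  · subst hp'
    rw [circleMean_top]
    refine (lintegral_mono fun θ => le_iSup (fun θ : ℝ => ‖f (circleMap 0 r θ)‖ₑ) θ).trans ?_
    simp
  · have h0 : p ≠ 0 := (zero_lt_one.trans_le hp).ne'
    rw [circleMean_eq_rpow hp', ← eLpNorm_eq_lintegral_rpow_enorm_toReal h0 hp',
      ← eLpNorm_one_eq_lintegral_enorm]
    exact eLpNorm_le_eLpNorm_of_exponent_le hp hc.aestronglyMeasurable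

/-! ### Monotonicity of the integral means -/

/-- Jensen's inequality for the `p`-th power of an average against a probability measure. -/
theorem lintegral_enorm_rpow_le {X : Type*} [MeasurableSpace X] (σ : Measure X)
    [IsProbabilityMeasure σ] {p : ℝ} (hp : 1 ≤ p) {u : X → ℂ} (hu : AEStronglyMeasurable u σ) :
    (∫⁻ x, ‖u x‖ₑ ∂σ) ^ p ≤ ∫⁻ x, ‖u x‖ₑ ^ p ∂σ := by
  have h0 : 0 < p := by linarith
  have h := eLpNorm'_le_eLpNorm'_of_exponent_le zero_lt_one hp σ hu
  simp only [eLpNorm'_eq_lintegral_enorm, ENNReal.rpow_one, div_one] at h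
  refine (ENNReal.rpow_le_rpow h h0.le).trans ?_
  rw [← ENNReal.rpow_mul, one_div_mul_cancel h0.ne', ENNReal.rpow_one]

/-- The Poisson integral formula, read as a statement on dilations: `f(sz)`, `0 ≤ s < 1`, is the
average of the rotations `f(e^{iψ}z)` against a probability measure that depends on `s` only. -/
theorem exists_enorm_dilation_le {s : ℝ} (hs0 : 0 ≤ s) (hs1 : s < 1) :
    ∃ σ : Measure ℝ, IsProbabilityMeasure σ ∧ ∀ f : ℂ → ℂ, Differentiable ℂ f → ∀ z : ℂ,
      ‖f (s * z)‖ₑ ≤ ∫⁻ ψ, ‖f (circleMap 0 1 ψ * z)‖ₑ ∂σ := by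
  have hsb : (s : ℂ) ∈ Metric.ball (0 : ℂ) 1 := by simpa [abs_of_nonneg hs0] using hs1
  have hne (ψ : ℝ) : circleMap 0 1 ψ - s ≠ 0 := by
    intro h
    have := congrArg norm (sub_eq_zero.mp h)
    simp [abs_of_nonneg hs0] at this
    linarith
  set P : ℝ → ℝ := fun ψ => poissonKernel 0 s (circleMap 0 1 ψ) with hP
  have hP' : P = fun ψ => (1 - s ^ 2) / ‖circleMap 0 1 ψ - s‖ ^ 2 := by
    funext ψ
    simp [hP, poissonKernel_def]
  have hP0 (ψ : ℝ) : 0 ≤ P ψ := by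
    rw [hP']
    have : 0 ≤ 1 - s ^ 2 := by nlinarith
    positivity
  have hPc : Continuous P := by
    rw [hP']
    refine continuous_const.div (by fun_prop) fun ψ => ?_
    simpa using hne ψ
  have hformula (g : ℂ → ℂ) (hg : Differentiable ℂ g) :
      ∫ ψ, P ψ • g (circleMap 0 1 ψ) ∂arcMeasure = g s := by
    rw [← hg.diffContOnCl.circleAverage_poissonKernel_smul hsb,
      circleAverage_eq_integral_arcMeasure]
    rfl
  have hbound (g : ℂ → ℂ) (hg : Differentiable ℂ g) :
      ‖g s‖ₑ ≤ ∫⁻ ψ, ‖g (circleMap 0 1 ψ)‖ₑ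
        ∂(arcMeasure.withDensity fun ψ => ENNReal.ofReal (P ψ)) := by
    have hgc : Continuous fun ψ : ℝ => g (circleMap 0 1 ψ) :=
      hg.continuous.comp (continuous_circleMap 0 1)
    rw [lintegral_withDensity_eq_lintegral_mul _ hPc.measurable.ennreal_ofReal
      hgc.enorm.measurable, ← hformula g hg]
    refine (enorm_integral_le_lintegral_enorm _).trans (le_of_eq ?_)
    refine lintegral_congr fun ψ => ?_
    rw [enorm_smul, Real.enorm_of_nonneg (hP0 ψ)]
    rfl
  refine ⟨arcMeasure.withDensity fun ψ => ENNReal.ofReal (P ψ), ⟨?_⟩, fun f hf z => ?_⟩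
  · have h1 := hformula (fun _ => 1) (differentiable_const _)
    have hint : Integrable P arcMeasure :=
      ((hPc.integrableOn_Icc (a := 0) (b := 2 * Real.pi)).mono_set Ioc_subset_Icc_self).smul_measure
        ENNReal.ofReal_ne_top
    rw [withDensity_apply _ MeasurableSet.univ, Measure.restrict_univ,
      ← ofReal_integral_eq_lintegral_ofReal hint (ae_of_all _ hP0)]
    have : ∫ ψ, P ψ ∂arcMeasure = 1 := by
      have h2 : ∫ ψ, ((P ψ : ℝ) : ℂ) ∂arcMeasure = 1 := by simpa using h1
      rw [integral_complex_ofReal] at h2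
      exact_mod_cast h2
    simp [this]
  · exact hbound (fun ζ => f (ζ * z)) (by fun_prop)

theorem circleMean_rotate (p : ℝ≥0∞) (f : ℂ → ℂ) (r ψ : ℝ) :
    circleMean p (fun z => f (circleMap 0 1 ψ * z)) r = circleMean p f r := by
  have hrot (θ : ℝ) : circleMap 0 1 ψ * circleMap 0 r θ = circleMap 0 r (θ + ψ) := by
    simp only [circleMap, zero_add, Complex.ofReal_one, one_mul, Complex.ofReal_add, add_mul,
      Complex.exp_add]
    ring
  by_cases hp : p = ∞
  · subst hp
    simp only [circleMean_top, hrot]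
    exact (Equiv.addRight ψ).iSup_comp (g := fun θ : ℝ => ‖f (circleMap 0 r θ)‖ₑ)
  · simp only [circleMean, if_neg hp, hrot]
    congr 2
    set u : ℝ → ℝ≥0∞ := fun θ => ‖f (circleMap 0 r θ)‖ₑ ^ p.toReal
    have hu : Function.Periodic u (2 * Real.pi) := fun θ => by
      simp only [u, periodic_circleMap 0 r θ]
    have h1 : ∫⁻ θ in Ioc 0 (2 * Real.pi), u (θ + ψ) = ∫⁻ θ in Ioc ψ (ψ + 2 * Real.pi), u θ := by
      have := (measurePreserving_add_right volume ψ).setLIntegral_comp_preimage_emb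
        (measurableEmbedding_addRight ψ) u (Ioc ψ (ψ + 2 * Real.pi))
      rw [← this]
      congr 2
      ext x
      simp
    have h2 : ∫⁻ θ in Ioc ψ (ψ + 2 * Real.pi), u θ = ∫⁻ θ in Ioc 0 (0 + 2 * Real.pi), u θ := by
      refine (isAddFundamentalDomain_Ioc Real.two_pi_pos ψ).setLIntegral_eq
        (isAddFundamentalDomain_Ioc Real.two_pi_pos 0) u ?_
      rintro ⟨g, hg⟩ x
      obtain ⟨n, rfl⟩ := AddSubgroup.mem_zmultiples_iff.mp hg
      change u (n • (2 * Real.pi) + x) = u x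
      rw [add_comm]
      exact hu.zsmul n x
    rw [h1, h2, zero_add]

/-- The means `M_p(f, r)` of an entire function increase with `r`. -/
theorem circleMean_dilation_le {p : ℝ≥0∞} (hp : 1 ≤ p) {f : ℂ → ℂ} (hf : Differentiable ℂ f)
    {s : ℝ} (hs0 : 0 ≤ s) (hs1 : s < 1) (r : ℝ) :
    circleMean p (fun z => f (s * z)) r ≤ circleMean p f r := by
  obtain ⟨σ, hσ, hle⟩ := exists_enorm_dilation_le hs0 hs1
  by_cases hp' : p = ∞
  · subst hp'
    rw [circleMean_top]
    refine iSup_le fun θ => (hle f hf _).trans ?_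
    calc ∫⁻ ψ, ‖f (circleMap 0 1 ψ * circleMap 0 r θ)‖ₑ ∂σ
        ≤ ∫⁻ _, circleMean ∞ f r ∂σ := by
          refine lintegral_mono fun ψ => ?_
          rw [← circleMean_rotate ∞ f r ψ, circleMean_top]
          exact le_iSup (fun θ : ℝ => ‖f (circleMap 0 1 ψ * circleMap 0 r θ)‖ₑ) θ
      _ = circleMean ∞ f r := by simp
  · have h1 := one_le_toReal hp hp'
    have h0 : 0 < p.toReal := by linarith
    have hc : Continuous fun x : ℝ × ℝ => f (circleMap 0 1 x.2 * circleMap 0 r x.1) := by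
      have := hf.continuous
      unfold circleMap
      fun_prop
    rw [circleMean_eq_rpow hp']
    calc (∫⁻ θ, ‖f (s * circleMap 0 r θ)‖ₑ ^ p.toReal ∂arcMeasure) ^ (1 / p.toReal)
        ≤ (∫⁻ θ, ∫⁻ ψ, ‖f (circleMap 0 1 ψ * circleMap 0 r θ)‖ₑ ^ p.toReal ∂σ ∂arcMeasure)
            ^ (1 / p.toReal) := by
          gcongr with θ
          refine (ENNReal.rpow_le_rpow (hle f hf _) h0.le).trans ?_
          exact lintegral_enorm_rpow_le σ h1
            (hc.comp (Continuous.prodMk_right θ)).aestronglyMeasurable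
      _ = (∫⁻ ψ, ∫⁻ θ, ‖f (circleMap 0 1 ψ * circleMap 0 r θ)‖ₑ ^ p.toReal ∂arcMeasure ∂σ)
            ^ (1 / p.toReal) := by
          rw [lintegral_lintegral_swap]
          exact (hc.enorm.measurable.pow_const _).aemeasurable
      _ = (∫⁻ _, circleMean p f r ^ p.toReal ∂σ) ^ (1 / p.toReal) := by
          congr 1
          refine lintegral_congr fun ψ => ?_
          rw [← circleMean_rotate p f r ψ, circleMean_eq_rpow hp', ← ENNReal.rpow_mul,
            one_div_mul_cancel h0.ne', ENNReal.rpow_one]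
      _ = circleMean p f r := by
          rw [lintegral_const, measure_univ, mul_one, ← ENNReal.rpow_mul,
            mul_one_div_cancel h0.ne', ENNReal.rpow_one]

/-! ### Taylor coefficients -/

/-- The `n`-th Taylor coefficient of `f` at the origin. -/
noncomputable def taylorCoeff (n : ℕ) (f : ℂ → ℂ) : ℂ := (n.factorial : ℂ)⁻¹ * iteratedDeriv n f 0

theorem hasSum_taylorCoeff {f : ℂ → ℂ} (hf : Differentiable ℂ f) (z : ℂ) :
    HasSum (fun n => taylorCoeff n f * z ^ n) (f z) := by
  convert! Complex.hasSum_taylorSeries_of_entire hf 0 z using 2 with n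
  simp only [taylorCoeff, sub_zero, smul_eq_mul]
  ring

theorem taylorCoeff_add (n : ℕ) {f g : ℂ → ℂ} (hf : Differentiable ℂ f) (hg : Differentiable ℂ g) :
    taylorCoeff n (f + g) = taylorCoeff n f + taylorCoeff n g := by
  rw [taylorCoeff, iteratedDeriv_add (hf.contDiff.contDiffAt) (hg.contDiff.contDiffAt), mul_add]
  rfl

theorem taylorCoeff_smul (n : ℕ) (c : ℂ) {f : ℂ → ℂ} (hf : Differentiable ℂ f) :
    taylorCoeff n (c • f) = c * taylorCoeff n f := by
  rw [taylorCoeff, iteratedDeriv_const_smul (hf.contDiff.contDiffAt), taylorCoeff, smul_eq_mul]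
  ring

/-- Cauchy's estimate for the Taylor coefficients, in terms of `M_p`. -/
theorem circleMean_taylorCoeff_le {p : ℝ≥0∞} (hp : 1 ≤ p) {f : ℂ → ℂ} (hf : Differentiable ℂ f)
    (n : ℕ) {r : ℝ} (hr : 0 < r) :
    circleMean p (fun z => taylorCoeff n f * z ^ n) r ≤ circleMean p f r := by
  -- Cauchy's formula on the circle of radius `r`, written with normalized arc length.
  have hcauchy : taylorCoeff n f = ∫ θ, (circleMap 0 r θ ^ n)⁻¹ * f (circleMap 0 r θ)
      ∂arcMeasure := by
    rw [← circleAverage_eq_integral_arcMeasure (fun z => (z ^ n)⁻¹ * f z),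
      Real.circleAverage_eq_circleIntegral hr.ne']
    have h := DiffContOnCl.circleIntegral_one_div_sub_center_pow_smul hr n
      (hf.diffContOnCl (s := Metric.ball 0 r))
    have hint : ∮ z in C(0, r), (z - 0)⁻¹ • ((z ^ n)⁻¹ * f z) =
        ∮ z in C(0, r), (1 / (z - 0) ^ (n + 1)) • f z := by
      congr 1
      funext z
      simp only [sub_zero, smul_eq_mul, pow_succ, one_div, mul_inv]
      ring
    rw [hint, h, taylorCoeff, smul_smul, smul_eq_mul]
    congr 1
    field_simp
  rw [circleMean_of_enorm_eq hp (C := ‖taylorCoeff n f‖ₑ * ENNReal.ofReal (r ^ n)) fun θ => by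
    rw [enorm_mul, ← ofReal_norm (circleMap 0 r θ ^ n), norm_pow, norm_circleMap_zero,
      abs_of_pos hr]]
  refine le_trans ?_ (lintegral_enorm_le_circleMean hp hf.continuous r)
  calc ‖taylorCoeff n f‖ₑ * ENNReal.ofReal (r ^ n)
      ≤ (∫⁻ θ, ‖(circleMap 0 r θ ^ n)⁻¹ * f (circleMap 0 r θ)‖ₑ ∂arcMeasure) *
          ENNReal.ofReal (r ^ n) := by
        rw [hcauchy]
        gcongr
        exact enorm_integral_le_lintegral_enorm _
    _ = ∫⁻ θ, ‖f (circleMap 0 r θ)‖ₑ ∂arcMeasure := by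
        rw [← lintegral_mul_const' _ _ ENNReal.ofReal_ne_top]
        refine lintegral_congr fun θ => ?_
        rw [enorm_mul, mul_comm, ← mul_assoc, ← ofReal_norm (circleMap 0 r θ ^ n)⁻¹, norm_inv,
          norm_pow, norm_circleMap_zero, abs_of_pos hr, ← ENNReal.ofReal_mul (by positivity),
          mul_inv_cancel₀ (by positivity), ENNReal.ofReal_one, one_mul]

/-! ### The mixed norm -/

theorem mixedNorm_top (p : ℝ≥0∞) (φ : RadialWeight) (f : ℂ → ℂ) :
    mixedNorm p ∞ φ f =
      ⨆ r : Ici (0 : ℝ), circleMean p f r * ENNReal.ofReal (Real.exp (-φ r)) := by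
  simp [mixedNorm]

theorem mixedNorm_mono (p q : ℝ≥0∞) (φ : RadialWeight) {f g : ℂ → ℂ}
    (h : ∀ r, 0 ≤ r → circleMean p f r ≤ circleMean p g r) :
    mixedNorm p q φ f ≤ mixedNorm p q φ g := by
  by_cases hq : q = ∞
  · subst hq
    simp only [mixedNorm_top]
    gcongr with r
    exact h r r.2
  · simp only [mixedNorm, if_neg hq]
    refine ENNReal.rpow_le_rpow (setLIntegral_mono' measurableSet_Ioi fun r hr => ?_)
      (by positivity)
    gcongr
    exact h r (le_of_lt hr)

theorem tendsto_circleMean {p : ℝ≥0∞} (hp : 1 ≤ p) {w : ℕ → ℂ → ℂ} {g : ℂ → ℂ} {r : ℝ}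
    (hw : ∀ m, Continuous (w m)) (hg : Continuous g)
    (h : ∀ R, TendstoUniformlyOn w g atTop (Metric.closedBall 0 R)) :
    Tendsto (fun m => circleMean p (w m) r) atTop (𝓝 (circleMean p g r)) := by
  have hev (ε : ℝ) (hε : 0 < ε) : ∀ᶠ m in atTop, ∀ θ,
      ‖g (circleMap 0 r θ) - w m (circleMap 0 r θ)‖ ≤ ε := by
    filter_upwards [Metric.tendstoUniformlyOn_iff.mp (h |r|) ε hε] with m hm θ
    rw [← dist_eq_norm]
    exact (hm _ (by simp)).le
  by_cases hx : circleMean p g r = ∞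
  -- An infinite mean forces the nearby means to be infinite as well.
  · refine tendsto_const_nhds.congr' ?_
    filter_upwards [hev 1 one_pos] with m hm
    have h1 := circleMean_le_add hp hg (hw m) hm
    rw [hx, top_le_iff, ENNReal.add_eq_top] at h1
    rw [hx, h1.resolve_right ENNReal.ofReal_ne_top]
  · rw [ENNReal.tendsto_nhds hx]
    intro ε hε
    obtain ⟨δ, hδ, hδε⟩ : ∃ δ : ℝ, 0 < δ ∧ ENNReal.ofReal δ ≤ ε := by
      obtain ⟨δ, hδ, hδε⟩ := ENNReal.lt_iff_exists_nnreal_btwn.mp hε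
      exact ⟨δ, by exact_mod_cast hδ, by simpa using hδε.le⟩
    filter_upwards [hev δ hδ] with m hm
    refine ⟨tsub_le_iff_right.mpr ((circleMean_le_add hp hg (hw m) hm).trans ?_),
      (circleMean_le_add hp (hw m) hg fun θ => ?_).trans (add_le_add_right hδε _)⟩
    · exact add_le_add_right hδε _
    · rw [norm_sub_rev]
      exact hm θ

/-- Fatou's lemma for the mixed norm: its balls are closed under locally uniform limits. -/
theorem mixedNorm_le_of_tendstoUniformlyOn {p q : ℝ≥0∞} (hp : 1 ≤ p) (hq : 1 ≤ q)
    (φ : RadialWeight) {w : ℕ → ℂ → ℂ} {g : ℂ → ℂ}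
    (hw : ∀ m, Continuous (w m)) (hg : Continuous g)
    (h : ∀ R, TendstoUniformlyOn w g atTop (Metric.closedBall 0 R)) {A : ℝ≥0∞}
    (hA : ∀ᶠ m in atTop, mixedNorm p q φ (w m) ≤ A) : mixedNorm p q φ g ≤ A := by
  by_cases hq' : q = ∞
  · subst hq'
    rw [mixedNorm_top]
    refine iSup_le fun r => ?_
    refine le_of_tendsto (ENNReal.Tendsto.mul_const (tendsto_circleMean hp hw hg h)
      (Or.inr ENNReal.ofReal_ne_top)) ?_
    filter_upwards [hA] with m hm
    rw [mixedNorm_top] at hm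
    exact (le_iSup (fun r : Ici (0 : ℝ) =>
      circleMean p (w m) r * ENNReal.ofReal (Real.exp (-φ r))) r).trans hm
  · have h0 : 0 < q.toReal := zero_lt_one.trans_le (one_le_toReal hq hq')
    set ρ : ℝ → ℝ≥0∞ := fun r => ENNReal.ofReal (Real.exp (-(q.toReal * φ r)) * r) with hρ
    have hρm : AEMeasurable ρ (volume.restrict (Ioi 0)) := by
      refine AEMeasurable.ennreal_ofReal (ContinuousOn.aemeasurable ?_ measurableSet_Ioi)
      have := φ.contDiffOn.continuousOn.mono Ioi_subset_Ici_self
      fun_prop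
    have hlim (r : ℝ) : liminf (fun m => circleMean p (w m) r ^ q.toReal * ρ r) atTop =
        circleMean p g r ^ q.toReal * ρ r :=
      (ENNReal.Tendsto.mul_const ((tendsto_circleMean hp hw hg h).ennrpow_const _)
        (Or.inr ENNReal.ofReal_ne_top)).liminf_eq
    have hle : ∫⁻ r in Ioi (0 : ℝ), circleMean p g r ^ q.toReal * ρ r ≤ A ^ q.toReal := by
      simp only [← hlim]
      refine (lintegral_liminf_le' fun m =>
        ((measurable_circleMean p (hw m)).pow_const _).aemeasurable.mul hρm).trans ?_
      refine liminf_le_of_frequently_le' (Eventually.frequently ?_)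
      filter_upwards [hA] with m hm
      rw [mixedNorm, if_neg hq'] at hm
      have := ENNReal.rpow_le_rpow hm h0.le
      rwa [← ENNReal.rpow_mul, one_div_mul_cancel h0.ne', ENNReal.rpow_one] at this
    rw [mixedNorm, if_neg hq']
    refine (ENNReal.rpow_le_rpow hle (by positivity)).trans ?_
    rw [← ENNReal.rpow_mul, mul_one_div_cancel h0.ne', ENNReal.rpow_one]

/-- For `φ` in the class `𝒞` the weight `exp (-φ)` decays faster than every power of `r`. -/
theorem RadialWeight.InClassC.exists_pow_mul_exp_le {φ : RadialWeight} (hφ : φ.InClassC) (n : ℕ) :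
    ∃ C, ∀ r, 0 ≤ r → r ^ n * Real.exp (-φ r) ≤ C := by
  obtain ⟨R, hR⟩ := eventually_atTop.mp (hφ.eventually_ge_atTop (n : ℝ))
  set S := max R 1 with hS
  have hS1 : 1 ≤ S := le_max_right _ _
  have hS0 : 0 < S := by linarith
  have hcont : ContinuousOn (fun r => φ r - n * Real.log r) (Ici S) := by
    have h1 : ContinuousOn φ.toFun (Ici S) := φ.contDiffOn.continuousOn.mono
      (Ici_subset_Ici.mpr hS0.le)
    refine h1.sub (continuousOn_const.mul (Real.continuousOn_log.mono fun r hr => ?_))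
    exact (hS0.trans_le hr).ne'
  -- `φ - n log` has nonnegative derivative where `r φ'(r) ≥ n`.
  have hmono : MonotoneOn (fun r => φ r - n * Real.log r) (Ici S) := by
    have hder (r : ℝ) (hr : r ∈ interior (Ici S)) :
        HasDerivAt (fun r => φ r - n * Real.log r) (deriv φ.toFun r - n * r⁻¹) r := by
      rw [interior_Ici] at hr
      have hr0 : 0 < r := hS0.trans hr
      have hd : DifferentiableAt ℝ φ.toFun r :=
        (φ.contDiffOn.differentiableOn one_ne_zero).differentiableAt (Ici_mem_nhds hr0)
      exact hd.hasDerivAt.sub ((Real.hasDerivAt_log hr0.ne').const_mul _)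
    refine monotoneOn_of_deriv_nonneg (convex_Ici S) hcont
      (fun r hr => (hder r hr).differentiableAt.differentiableWithinAt) fun r hr => ?_
    rw [(hder r hr).deriv]
    rw [interior_Ici] at hr
    have hr0 : 0 < r := hS0.trans hr
    have := hR r ((le_max_left _ _).trans (le_of_lt hr))
    rw [sub_nonneg, ← div_eq_mul_inv, div_le_iff₀ hr0]
    linarith
  -- The bound `Sⁿ` serves on both sides of `S`, since `φ ≥ 0`.
  refine ⟨S ^ n, fun r hr => ?_⟩
  rcases le_total r S with h | h
  · calc r ^ n * Real.exp (-φ r) ≤ S ^ n * 1 := by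
          gcongr
          exact Real.exp_le_one_iff.mpr (neg_nonpos.mpr (φ.nonneg r hr))
      _ = S ^ n := mul_one _
  · have hr0 : 0 < r := hS0.trans_le h
    have h1 := hmono self_mem_Ici h h
    have h2 := φ.nonneg S hS0.le
    simp only at h1
    calc r ^ n * Real.exp (-φ r) = Real.exp (n * Real.log r - φ r) := by
          rw [sub_eq_add_neg, Real.exp_add, ← Real.log_pow, Real.exp_log (by positivity)]
      _ ≤ Real.exp (n * Real.log S) := Real.exp_le_exp.mpr (by linarith)
      _ = S ^ n := by rw [← Real.log_pow, Real.exp_log (by positivity)]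

theorem mixedNorm_pow_lt_top {p q : ℝ≥0∞} (hp : 1 ≤ p) (hq : 1 ≤ q) {φ : RadialWeight}
    (hφ : φ.InClassC) (n : ℕ) : mixedNorm p q φ (fun z => z ^ n) < ∞ := by
  by_cases hq' : q = ∞
  · subst hq'
    obtain ⟨C, hC⟩ := hφ.exists_pow_mul_exp_le n
    rw [mixedNorm_top]
    refine (iSup_le fun r => ?_).trans_lt (ENNReal.ofReal_lt_top (r := C))
    rw [circleMean_pow hp n r.2, ← ENNReal.ofReal_mul (pow_nonneg r.2 n)]
    exact ENNReal.ofReal_le_ofReal (hC r r.2)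
  · have h1 := one_le_toReal hq hq'
    have h0 : 0 < q.toReal := by linarith
    obtain ⟨C, hC⟩ := hφ.exists_pow_mul_exp_le n
    obtain ⟨D, hD⟩ := hφ.exists_pow_mul_exp_le (n + 2)
    obtain ⟨E, hE⟩ := hφ.exists_pow_mul_exp_le (n + 4)
    -- The decay `(1 + r²)⁻²` survives the power `q ≥ 1` and pays for the factor `r ≤ 1 + r²`.
    set K := C + 2 * D + E with hK
    have hbound (r : ℝ) (hr : 0 ≤ r) : r ^ n * Real.exp (-φ r) ≤ K * ((1 + r ^ 2) ^ 2)⁻¹ := by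
      rw [← div_eq_mul_inv, le_div_iff₀ (by positivity)]
      calc r ^ n * Real.exp (-φ r) * (1 + r ^ 2) ^ 2
          = r ^ n * Real.exp (-φ r) + 2 * (r ^ (n + 2) * Real.exp (-φ r))
            + r ^ (n + 4) * Real.exp (-φ r) := by ring
        _ ≤ K := by linarith [hC r hr, hD r hr, hE r hr]
    have hK0 : 0 ≤ K := by
      have := hbound 0 le_rfl
      have h2 : 0 ≤ (0 : ℝ) ^ n * Real.exp (-φ 0) := by positivity
      norm_num at this
      linarith
    rw [mixedNorm, if_neg hq']
    refine ENNReal.rpow_lt_top_of_nonneg (by positivity) (ne_of_lt ?_)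
    calc ∫⁻ r in Ioi (0 : ℝ), circleMean p (fun z => z ^ n) r ^ q.toReal *
          ENNReal.ofReal (Real.exp (-(q.toReal * φ r)) * r)
        ≤ ∫⁻ r in Ioi (0 : ℝ), ENNReal.ofReal (K ^ q.toReal * (1 + r ^ 2)⁻¹) := by
          refine setLIntegral_mono' measurableSet_Ioi fun r hr => ?_
          have hr : 0 < r := hr
          rw [circleMean_pow hp n hr.le, ENNReal.ofReal_rpow_of_nonneg (by positivity) h0.le,
            ← ENNReal.ofReal_mul (by positivity)]
          refine ENNReal.ofReal_le_ofReal ?_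
          have he : Real.exp (-(q.toReal * φ r)) = Real.exp (-φ r) ^ q.toReal := by
            rw [← Real.exp_mul]
            ring_nf
          have hr1 : r ≤ 1 + r ^ 2 := by nlinarith [sq_nonneg (r - 1)]
          have h2 : ((1 + r ^ 2) ^ 2)⁻¹ ^ q.toReal ≤ ((1 + r ^ 2) ^ 2)⁻¹ := by
            refine Real.rpow_le_self_of_le_one (by positivity) ?_ h1
            exact inv_le_one_of_one_le₀ (one_le_pow₀ (by nlinarith))
          calc (r ^ n) ^ q.toReal * (Real.exp (-(q.toReal * φ r)) * r)
              = (r ^ n * Real.exp (-φ r)) ^ q.toReal * r := by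
                rw [he, Real.mul_rpow (by positivity) (by positivity), mul_assoc]
            _ ≤ (K * ((1 + r ^ 2) ^ 2)⁻¹) ^ q.toReal * (1 + r ^ 2) := by
                have h3 : 0 ≤ r ^ n * Real.exp (-φ r) := by positivity
                exact mul_le_mul (Real.rpow_le_rpow h3 (hbound r hr.le) h0.le) hr1 hr.le
                  (Real.rpow_nonneg (h3.trans (hbound r hr.le)) _)
            _ = K ^ q.toReal * (((1 + r ^ 2) ^ 2)⁻¹ ^ q.toReal * (1 + r ^ 2)) := by
                rw [Real.mul_rpow hK0 (by positivity), mul_assoc]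
            _ ≤ K ^ q.toReal * (((1 + r ^ 2) ^ 2)⁻¹ * (1 + r ^ 2)) := by gcongr
            _ = K ^ q.toReal * (1 + r ^ 2)⁻¹ := by
                have : 1 + r ^ 2 ≠ 0 := by positivity
                field_simp
      _ < ∞ := ((integrable_inv_one_add_sq.const_mul _).integrableOn).lintegral_lt_top

theorem mixedNorm_taylorCoeff_le {p q : ℝ≥0∞} (hp : 1 ≤ p) (hq : 1 ≤ q) (φ : RadialWeight)
    {f : ℂ → ℂ} (hf : Differentiable ℂ f) (n : ℕ) :
    ‖taylorCoeff n f‖ₑ * mixedNorm p q φ (fun z => z ^ n) ≤ mixedNorm p q φ f := by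
  rw [← mixedNorm_smul hp hq]
  refine mixedNorm_mono p q φ fun r hr => ?_
  rcases hr.eq_or_lt with rfl | hr
  -- At radius `0`, which counts when `q = ∞`, only the constant term is left.
  · refine circleMean_mono p fun θ => ?_
    rcases Nat.eq_zero_or_pos n with rfl | hn
    · simp [taylorCoeff]
    · simp [hn.ne']
  · exact circleMean_taylorCoeff_le hp hf n hr

theorem mixedNorm_dilation_le {p q : ℝ≥0∞} (hp : 1 ≤ p) (φ : RadialWeight)
    {f : ℂ → ℂ} (hf : Differentiable ℂ f) {s : ℝ} (hs0 : 0 ≤ s) (hs1 : s < 1) :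
    mixedNorm p q φ (fun z => f (s * z)) ≤ mixedNorm p q φ f :=
  mixedNorm_mono p q φ fun r _ => circleMean_dilation_le hp hf hs0 hs1 r

/-! ### Coefficients, point evaluations and completeness of the Fock space -/

namespace FockSpace

variable {p q : ℝ≥0∞} [hp : Fact (1 ≤ p)] [hq : Fact (1 ≤ q)] {φ : RadialWeight}

/-- An entire function of finite mixed norm, as an element of the Fock space. -/
def ofEntire (f : ℂ → ℂ) (hf : Differentiable ℂ f) (hfin : mixedNorm p q φ f < ∞) :
    FockSpace p q φ :=
  (⟨f, hf, hfin⟩ : ↥(fockSubmodule p q φ))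

theorem differentiable (f : FockSpace p q φ) : Differentiable ℂ f := f.2.1

theorem mixedNorm_lt_top (f : FockSpace p q φ) : mixedNorm p q φ f < ∞ := f.2.2

theorem norm_eq (f : FockSpace p q φ) : ‖f‖ = (mixedNorm p q φ f).toReal := rfl

theorem ofReal_norm_eq (f : FockSpace p q φ) : ENNReal.ofReal ‖f‖ = mixedNorm p q φ f := by
  rw [norm_eq, ENNReal.ofReal_toReal f.mixedNorm_lt_top.ne]

theorem ext_apply {f g : FockSpace p q φ} (h : ∀ z, f z = g z) : f = g :=
  Subtype.ext (funext h)

@[simp] theorem toFun_sub (f g : FockSpace p q φ) : (f - g).toFun = f.toFun - g.toFun := rfl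

@[simp] theorem toFun_zero : (0 : FockSpace p q φ).toFun = 0 := rfl

/-- The monomial `z ^ n`, which lies in the space because the weight is in the class `𝒞`. -/
noncomputable def monomial (hφ : φ.InClassC) (n : ℕ) : FockSpace p q φ :=
  ofEntire (fun z => z ^ n) (by fun_prop) (mixedNorm_pow_lt_top hp.out hq.out hφ n)

theorem monomial_apply (hφ : φ.InClassC) (n : ℕ) (z : ℂ) :
    (monomial hφ n : FockSpace p q φ) z = z ^ n := rfl

theorem norm_monomial_pos (hφ : φ.InClassC) (n : ℕ) :
    0 < ‖(monomial hφ n : FockSpace p q φ)‖ := by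
  rw [norm_pos_iff]
  intro h
  have h1 : (monomial hφ n : FockSpace p q φ) 1 = (0 : FockSpace p q φ) 1 := by rw [h]
  simp [monomial_apply] at h1

theorem norm_taylorCoeff_mul_le (hφ : φ.InClassC) (n : ℕ) (f : FockSpace p q φ) :
    ‖taylorCoeff n f‖ * ‖(monomial hφ n : FockSpace p q φ)‖ ≤ ‖f‖ := by
  have h := mixedNorm_taylorCoeff_le hp.out hq.out φ f.differentiable n
  have := ENNReal.toReal_mono f.mixedNorm_lt_top.ne h
  rwa [ENNReal.toReal_mul, toReal_enorm] at this

/-- The `n`-th Taylor coefficient, as a continuous functional. -/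
noncomputable def coeff (hφ : φ.InClassC) (n : ℕ) : FockSpace p q φ →L[ℂ] ℂ :=
  LinearMap.mkContinuous
    { toFun := fun f => taylorCoeff n f
      map_add' := fun f g => taylorCoeff_add n f.differentiable g.differentiable
      map_smul' := fun c f => taylorCoeff_smul n c f.differentiable }
    ‖(monomial hφ n : FockSpace p q φ)‖⁻¹ fun f => by
      rw [← div_eq_inv_mul, le_div_iff₀ (norm_monomial_pos hφ n)]
      exact norm_taylorCoeff_mul_le hφ n f

/-- The rank one operator sending `f = ∑ aₙ zⁿ` to its `n`-th term `aₙ zⁿ`. -/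
noncomputable def term (hφ : φ.InClassC) (n : ℕ) : FockSpace p q φ →L[ℂ] FockSpace p q φ :=
  (coeff hφ n).smulRight (monomial hφ n)

theorem norm_term_le (hφ : φ.InClassC) (n : ℕ) :
    ‖(term hφ n : FockSpace p q φ →L[ℂ] FockSpace p q φ)‖ ≤ 1 := by
  refine ContinuousLinearMap.opNorm_le_bound _ zero_le_one fun f => ?_
  rw [term, ContinuousLinearMap.smulRight_apply, norm_smul, one_mul]
  exact norm_taylorCoeff_mul_le hφ n f

theorem isCompactOperator_term (hφ : φ.InClassC) (n : ℕ) :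
    IsCompactOperator (term hφ n : FockSpace p q φ →L[ℂ] FockSpace p q φ) := by
  have h : IsCompactOperator (coeff hφ n : FockSpace p q φ →L[ℂ] ℂ) :=
    isCompactOperator_of_locallyCompactSpace_dom _
  exact h.clm_comp ((ContinuousLinearMap.id ℂ ℂ).smulRight (monomial hφ n : FockSpace p q φ))

/-- The hypothesis `‖zⁿ‖^{1/n} → ∞` in the form `∑ Rⁿ / ‖zⁿ‖ < ∞` for every `R`. -/
theorem summable_pow_div_norm_monomial (hφ : φ.InClassC)
    (hz : Tendsto (fun n : ℕ => mixedNorm p q φ (fun z => z ^ n) ^ (1 / (n : ℝ))) atTop (𝓝 ∞))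
    {R : ℝ} (hR : 0 ≤ R) :
    Summable fun n : ℕ => R ^ n / ‖(monomial hφ n : FockSpace p q φ)‖ := by
  -- Once `‖zⁿ‖^{1/n} ≥ 2R`, the terms are at most `2⁻ⁿ`.
  refine Summable.of_norm_bounded_eventually_nat
    (summable_geometric_of_lt_one (by norm_num : (0 : ℝ) ≤ 1 / 2) (by norm_num)) ?_
  filter_upwards [hz.eventually (eventually_ge_nhds (ENNReal.ofReal_lt_top (r := 2 * R))),
    eventually_gt_atTop 0] with n hn hn0
  have hn0' : (0 : ℝ) < n := by exact_mod_cast hn0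
  have hpos := norm_monomial_pos (p := p) (q := q) hφ n
  have h1 : (2 * R) ^ n ≤ ‖(monomial hφ n : FockSpace p q φ)‖ := by
    have h2 := ENNReal.rpow_le_rpow hn hn0'.le
    rw [← ENNReal.rpow_mul, one_div_mul_cancel hn0'.ne', ENNReal.rpow_one, ENNReal.rpow_natCast,
      ← ENNReal.ofReal_pow (by positivity)] at h2
    have h3 := ofReal_norm_eq (monomial hφ n : FockSpace p q φ)
    have h4 : ENNReal.ofReal ((2 * R) ^ n) ≤
        ENNReal.ofReal ‖(monomial hφ n : FockSpace p q φ)‖ := h2.trans_eq h3.symm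
    exact (ENNReal.ofReal_le_ofReal_iff hpos.le).mp h4
  rw [Real.norm_of_nonneg (by positivity), div_le_iff₀ hpos]
  calc R ^ n = (1 / 2) ^ n * (2 * R) ^ n := by rw [← mul_pow]; ring_nf
    _ ≤ _ := by gcongr

theorem norm_apply_le (hφ : φ.InClassC)
    (hz : Tendsto (fun n : ℕ => mixedNorm p q φ (fun z => z ^ n) ^ (1 / (n : ℝ))) atTop (𝓝 ∞))
    (f : FockSpace p q φ) {z : ℂ} {R : ℝ} (hzR : ‖z‖ ≤ R) :
    ‖f z‖ ≤ (∑' n : ℕ, R ^ n / ‖(monomial hφ n : FockSpace p q φ)‖) * ‖f‖ := by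
  have hR : 0 ≤ R := (norm_nonneg z).trans hzR
  have hs := (summable_pow_div_norm_monomial (p := p) (q := q) hφ hz hR).hasSum.mul_right ‖f‖
  rw [← (hasSum_taylorCoeff f.differentiable z).tsum_eq]
  refine tsum_of_norm_bounded hs fun n => ?_
  have hpos := norm_monomial_pos (p := p) (q := q) hφ n
  rw [norm_mul, norm_pow, div_mul_eq_mul_div, le_div_iff₀ hpos]
  calc ‖taylorCoeff n f‖ * ‖z‖ ^ n * ‖(monomial hφ n : FockSpace p q φ)‖
      = ‖z‖ ^ n * (‖taylorCoeff n f‖ * ‖(monomial hφ n : FockSpace p q φ)‖) := by ring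
    _ ≤ R ^ n * ‖f‖ := by
        gcongr
        exact norm_taylorCoeff_mul_le hφ n f

/-- Evaluation at `z`, as a continuous functional. -/
noncomputable def eval (hφ : φ.InClassC)
    (hz : Tendsto (fun n : ℕ => mixedNorm p q φ (fun z => z ^ n) ^ (1 / (n : ℝ))) atTop (𝓝 ∞))
    (z : ℂ) : FockSpace p q φ →L[ℂ] ℂ :=
  LinearMap.mkContinuous
    { toFun := fun f => f z
      map_add' := fun _ _ => rfl
      map_smul' := fun _ _ => rfl } _ fun f => norm_apply_le hφ hz f le_rfl

theorem completeSpace (hφ : φ.InClassC)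
    (hz : Tendsto (fun n : ℕ => mixedNorm p q φ (fun z => z ^ n) ^ (1 / (n : ℝ))) atTop (𝓝 ∞)) :
    CompleteSpace (FockSpace p q φ) := by
  refine Metric.complete_of_cauchySeq_tendsto fun u hu => ?_
  have hlim (z : ℂ) : ∃ w, Tendsto (fun n => u n z) atTop (𝓝 w) :=
    cauchySeq_tendsto_of_complete (hu.map (eval hφ hz z).uniformContinuous)
  choose g hg using hlim
  have hunif (R : ℝ) : TendstoUniformlyOn (fun n => (u n).toFun) g atTop
      (Metric.closedBall 0 R) := by
    refine UniformCauchySeqOn.tendstoUniformlyOn_of_tendsto ?_ fun z _ => hg z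
    rw [Metric.uniformCauchySeqOn_iff]
    intro ε hε
    set C := ∑' n : ℕ, R ^ n / ‖(monomial hφ n : FockSpace p q φ)‖ with hC
    obtain ⟨N, hN⟩ := Metric.cauchySeq_iff.mp hu (ε / (|C| + 1)) (by positivity)
    refine ⟨N, fun m hm n hn z hzR => ?_⟩
    have h1 := norm_apply_le hφ hz (u m - u n) (mem_closedBall_zero_iff.mp hzR)
    have h2 := hN m hm n hn
    rw [dist_eq_norm] at h2 ⊢
    rw [lt_div_iff₀ (by positivity)] at h2
    calc ‖u m z - u n z‖ ≤ C * ‖u m - u n‖ := h1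
      _ ≤ ‖u m - u n‖ * (|C| + 1) := by nlinarith [le_abs_self C, norm_nonneg (u m - u n)]
      _ < ε := h2
  have hgd : Differentiable ℂ g := by
    rw [← differentiableOn_univ]
    refine TendstoLocallyUniformlyOn.differentiableOn (φ := atTop) (F := fun n => (u n).toFun) ?_
      (Eventually.of_forall fun n => (u n).differentiable.differentiableOn) isOpen_univ
    rw [tendstoLocallyUniformlyOn_iff_forall_isCompact isOpen_univ]
    intro K _ hK
    obtain ⟨R, hR⟩ := hK.isBounded.subset_closedBall 0
    exact (hunif R).mono hR
  have hclose (ε : ℝ) (hε : 0 < ε) : ∃ N, ∀ n ≥ N,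
      mixedNorm p q φ ((u n).toFun - g) ≤ ENNReal.ofReal ε := by
    obtain ⟨N, hN⟩ := Metric.cauchySeq_iff.mp hu ε hε
    refine ⟨N, fun n hn => mixedNorm_le_of_tendstoUniformlyOn hp.out hq.out φ
      (w := fun m => (u n - u m).toFun) (fun m => (u n - u m).differentiable.continuous)
      ((u n).differentiable.sub hgd).continuous (fun R => ?_) ?_⟩
    · rw [Metric.tendstoUniformlyOn_iff]
      intro δ hδ
      filter_upwards [Metric.tendstoUniformlyOn_iff.mp (hunif R) δ hδ] with m hm z hzR
      simpa only [toFun_sub, Pi.sub_apply, dist_sub_left] using hm z hzR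
    · filter_upwards [eventually_ge_atTop N] with m hm
      rw [← ofReal_norm_eq, ← dist_eq_norm]
      exact ENNReal.ofReal_le_ofReal (hN n hn m hm).le
  obtain ⟨N, hN⟩ := hclose 1 one_pos
  have hmem : g ∈ fockSubmodule p q φ := by
    have h1 : (u N).toFun - g ∈ fockSubmodule p q φ :=
      ⟨(u N).differentiable.sub hgd, (hN N le_rfl).trans_lt ENNReal.ofReal_lt_top⟩
    have h2 := (fockSubmodule p q φ).sub_mem (u N).2 h1
    rwa [show (u N).1 - ((u N).toFun - g) = g from sub_sub_cancel _ _] at h2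
  refine ⟨ofEntire g hmem.1 hmem.2, Metric.tendsto_atTop.mpr fun ε hε => ?_⟩
  obtain ⟨M, hM⟩ := hclose (ε / 2) (by positivity)
  refine ⟨M, fun n hn => ?_⟩
  rw [dist_eq_norm, norm_eq]
  refine (ENNReal.toReal_mono ENNReal.ofReal_ne_top (hM n hn)).trans_lt ?_
  rw [ENNReal.toReal_ofReal (by positivity)]
  linarith

end FockSpace

/-! ### Integrals of compact operators -/

theorem integral_mem_of_isClosed {X F : Type*} [MeasurableSpace X] [NormedAddCommGroup F]
    [NormedSpace ℂ F] [CompleteSpace F] {μ : Measure X} (K : Submodule ℂ F)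
    (hK : IsClosed (K : Set F)) {D : X → F} (hD : ∀ᵐ x ∂μ, D x ∈ K) : ∫ x, D x ∂μ ∈ K := by
  by_cases hint : Integrable D μ
  swap
  · rw [integral_undef hint]
    exact K.zero_mem
  have : IsClosed (K : Set F) := hK
  refine (Submodule.Quotient.mk_eq_zero K).mp ?_
  -- The continuous quotient map by `K` commutes with the integral.
  refine (K.mkQL.integral_comp_comm hint).symm.trans (integral_eq_zero_of_ae ?_)
  filter_upwards [hD] with x hx
  exact (Submodule.Quotient.mk_eq_zero K).mpr hx

/-- A Bochner integral of compact operators, taken in the operator norm, is compact. -/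
theorem isCompactOperator_integral {X E : Type*} [MeasurableSpace X] [NormedAddCommGroup E]
    [NormedSpace ℂ E] [CompleteSpace E] {μ : Measure X} {D : X → E →L[ℂ] E}
    (hD : ∀ᵐ x ∂μ, IsCompactOperator (D x)) : IsCompactOperator (∫ x, D x ∂μ : E →L[ℂ] E) :=
  integral_mem_of_isClosed (compactOperator (RingHom.id ℂ) E E)
    isClosed_setOfPred_isCompactOperator hD

/-! ### Dilations -/

namespace FockSpace

variable {p q : ℝ≥0∞} [hp : Fact (1 ≤ p)] [hq : Fact (1 ≤ q)] {φ : RadialWeight}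

/-- The dilation `f ↦ f(s ·)`, for `0 ≤ s < 1`, defined as the operator `∑ sⁿ Rₙ`, where `Rₙ` is the
projection `term hφ n` of norm at most one. For `s ≥ 1` the value is not used: the series need not
converge, and `tsum` then returns `0`. -/
noncomputable def dilation (hφ : φ.InClassC) (s : ℝ) : FockSpace p q φ →L[ℂ] FockSpace p q φ :=
  ∑' n : ℕ, ((s : ℂ) ^ n) • term hφ n

section

variable (hφ : φ.InClassC)
  (hz : Tendsto (fun n : ℕ => mixedNorm p q φ (fun z => z ^ n) ^ (1 / (n : ℝ))) atTop (𝓝 ∞))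
  {s : ℝ} (hs0 : 0 ≤ s) (hs1 : s < 1)

include hz hs0 hs1

theorem hasSum_dilation : HasSum (fun n : ℕ => ((s : ℂ) ^ n) • term (p := p) (q := q) hφ n)
    (dilation hφ s) := by
  have := completeSpace hφ hz
  refine Summable.hasSum (Summable.of_norm_bounded (summable_geometric_of_lt_one hs0 hs1)
    fun n => ?_)
  rw [norm_smul, norm_pow, Complex.norm_real, Real.norm_of_nonneg hs0]
  exact mul_le_of_le_one_right (by positivity) (norm_term_le hφ n)

theorem dilation_apply (f : FockSpace p q φ) (z : ℂ) : dilation hφ s f z = f (s * z) := by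
  have h1 := (hasSum_dilation hφ hz hs0 hs1).mapL
    ((eval hφ hz z).comp (ContinuousLinearMap.apply ℂ (FockSpace p q φ) f))
  have h2 := hasSum_taylorCoeff f.differentiable (s * z)
  refine h1.unique (h2.congr_fun fun n => ?_)
  change (s : ℂ) ^ n * (taylorCoeff n f * z ^ n) = _
  rw [mul_pow]
  ring

theorem norm_dilation_le : ‖(dilation hφ s : FockSpace p q φ →L[ℂ] FockSpace p q φ)‖ ≤ 1 := by
  refine ContinuousLinearMap.opNorm_le_bound _ zero_le_one fun f => ?_
  rw [one_mul, norm_eq, norm_eq]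
  refine ENNReal.toReal_mono f.mixedNorm_lt_top.ne ?_
  rw [show (dilation hφ s f).toFun = fun z => f (s * z) from
    funext (dilation_apply hφ hz hs0 hs1 f)]
  exact mixedNorm_dilation_le hp.out φ f.differentiable hs0 hs1

theorem isCompactOperator_dilation :
    IsCompactOperator (dilation hφ s : FockSpace p q φ →L[ℂ] FockSpace p q φ) := by
  have := completeSpace hφ hz
  refine isCompactOperator_of_tendsto (hasSum_dilation hφ hz hs0 hs1).tendsto_sum_nat
    (Eventually.of_forall fun N => ?_)
  exact (compactOperator (RingHom.id ℂ) _ _).sum_mem fun n _ =>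
    (compactOperator (RingHom.id ℂ) _ _).smul_mem _ (isCompactOperator_term hφ n)

end

end FockSpace

open FockSpace

/-! ### Compactness of the Hausdorff operator -/

/-- If `μ` lives on `(1, ∞)` and `1 / t` is integrable, then `H_μ` is the Bochner integral of the
compact operators `t⁻¹ D_{1/t}`, whose norms are at most `1 / t`. -/
theorem exists_isCompactOperator_of_integrable {p q : ℝ≥0∞} [hp : Fact (1 ≤ p)]
    [hq : Fact (1 ≤ q)] {φ : RadialWeight} (hφ : φ.InClassC)
    (hz : Tendsto (fun n : ℕ => mixedNorm p q φ (fun z => z ^ n) ^ (1 / (n : ℝ))) atTop (𝓝 ∞))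
    {μ : Measure (Ioi (0 : ℝ))} (hμ : ∀ᵐ t : Ioi (0 : ℝ) ∂μ, 1 < (t : ℝ))
    (hint : Integrable (fun t : Ioi (0 : ℝ) => 1 / (t : ℝ)) μ) :
    ∃ T : FockSpace p q φ →L[ℂ] FockSpace p q φ, IsHausdorffOperator μ T ∧ IsCompactOperator T := by
  have := completeSpace hφ hz
  set D : Ioi (0 : ℝ) → FockSpace p q φ →L[ℂ] FockSpace p q φ :=
    fun t => ((1 / (t : ℝ) : ℝ) : ℂ) • dilation hφ (1 / (t : ℝ)) with hD
  have hinv {t : Ioi (0 : ℝ)} (ht : 1 < (t : ℝ)) : 0 ≤ 1 / (t : ℝ) ∧ 1 / (t : ℝ) < 1 :=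
    ⟨one_div_nonneg.mpr (zero_lt_one.trans ht).le, (div_lt_one (zero_lt_one.trans ht)).mpr ht⟩
  have hcoe : Measurable fun t : Ioi (0 : ℝ) => ((1 / (t : ℝ) : ℝ) : ℂ) := by fun_prop
  -- The operator space need not be separable: measurability comes from the partial sums.
  have hDm : AEStronglyMeasurable D μ := by
    refine AEStronglyMeasurable.smul hcoe.aestronglyMeasurable ?_
    refine aestronglyMeasurable_of_tendsto_ae atTop (f := fun (N : ℕ) (t : Ioi (0 : ℝ)) =>
      ∑ n ∈ Finset.range N, (((1 / (t : ℝ) : ℝ) : ℂ) ^ n) • term hφ n) (fun N => ?_) ?_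
    · refine Finset.aestronglyMeasurable_fun_sum _ fun n _ => ?_
      exact (hcoe.pow_const n).aestronglyMeasurable.smul_const _
    · filter_upwards [hμ] with t ht
      exact (hasSum_dilation hφ hz (hinv ht).1 (hinv ht).2).tendsto_sum_nat
  have hDi : Integrable D μ := by
    refine hint.mono hDm ?_
    filter_upwards [hμ] with t ht
    rw [hD, norm_smul, Complex.norm_real]
    exact mul_le_of_le_one_right (norm_nonneg _) (norm_dilation_le hφ hz (hinv ht).1 (hinv ht).2)
  have hker (f : FockSpace p q φ) (z : ℂ) :
      (fun t => (eval hφ hz z).comp (ContinuousLinearMap.apply ℂ (FockSpace p q φ) f) (D t))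
        =ᵐ[μ] hausdorffKernel f z := by
    filter_upwards [hμ] with t ht
    have h1 := dilation_apply hφ hz (hinv ht).1 (hinv ht).2 f z
    change ((1 / (t : ℝ) : ℝ) : ℂ) * dilation hφ (1 / (t : ℝ)) f z = _
    rw [h1, hausdorffKernel]
    push_cast
    rw [one_div_mul_eq_div (t : ℂ) z]
  refine ⟨∫ t, D t ∂μ, fun f z => ⟨?_, ?_⟩, isCompactOperator_integral ?_⟩
  · exact (ContinuousLinearMap.integrable_comp _ hDi).congr (hker f z)
  · rw [← integral_congr_ae (hker f z), ContinuousLinearMap.integral_comp_comm _ hDi]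
    rfl
  · filter_upwards [hμ] with t ht
    exact (compactOperator (RingHom.id ℂ) _ _).smul_mem _
      (isCompactOperator_dilation hφ hz (hinv ht).1 (hinv ht).2)

/-- A compact Hausdorff operator forces `μ((0, 1]) = 0`: it multiplies `zⁿ` by
`∫ t^{-(n+1)} dμ ≥ μ((0, 1])`, while the normalized monomials tend to `0` pointwise. -/
theorem measure_eq_zero_of_isCompactOperator {p q : ℝ≥0∞} [hp : Fact (1 ≤ p)]
    [hq : Fact (1 ≤ q)] {φ : RadialWeight} (hφ : φ.InClassC)
    (hz : Tendsto (fun n : ℕ => mixedNorm p q φ (fun z => z ^ n) ^ (1 / (n : ℝ))) atTop (𝓝 ∞))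
    {μ : Measure (Ioi (0 : ℝ))} {T : FockSpace p q φ →L[ℂ] FockSpace p q φ}
    (hT : IsHausdorffOperator μ T) (hTc : IsCompactOperator T) :
    μ {t : Ioi (0 : ℝ) | (t : ℝ) ≤ 1} = 0 := by
  set S : Set (Ioi (0 : ℝ)) := {t | (t : ℝ) ≤ 1} with hS
  have hSm : MeasurableSet S := measurableSet_le measurable_subtype_coe measurable_const
  have hker (n : ℕ) (z : ℂ) (t : Ioi (0 : ℝ)) :
      hausdorffKernel (monomial hφ n : FockSpace p q φ) z t =
        (((1 / (t : ℝ)) ^ (n + 1) : ℝ) : ℂ) * z ^ n := by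
    rw [hausdorffKernel, monomial_apply]
    push_cast
    rw [div_pow, pow_succ, one_div, div_eq_mul_inv, inv_pow]
    ring
  set c : ℕ → ℝ := fun n => ∫ t : Ioi (0 : ℝ), (1 / (t : ℝ)) ^ (n + 1) ∂μ with hc
  have hint (n : ℕ) : Integrable (fun t : Ioi (0 : ℝ) => (1 / (t : ℝ)) ^ (n + 1)) μ := by
    have h := (hT (monomial hφ n) 1).1
    have h2 : hausdorffKernel (monomial hφ n : FockSpace p q φ) 1 =
        fun t : Ioi (0 : ℝ) => (((1 / (t : ℝ)) ^ (n + 1) : ℝ) : ℂ) := by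
      funext t
      rw [hker, one_pow, mul_one]
    rw [h2] at h
    exact h.re
  have hone {t : Ioi (0 : ℝ)} (ht : t ∈ S) : 1 ≤ 1 / (t : ℝ) := (one_le_div t.2).mpr ht
  have heigen (n : ℕ) : T (monomial hφ n) = (c n : ℂ) • monomial hφ n := by
    refine ext_apply fun z => ?_
    rw [(hT (monomial hφ n) z).2]
    simp only [hker]
    rw [integral_mul_const, integral_complex_ofReal]
    rfl
  have hSfin : μ S ≠ ∞ := by
    refine ((measure_mono fun t ht => ?_).trans_lt
      ((hint 0).measure_norm_ge_lt_top one_pos)).ne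
    have := hone ht
    simpa [abs_of_pos t.2.out] using this
  by_contra hne
  set m : ℝ := μ.real S with hm
  have hm0 : 0 < m := ENNReal.toReal_pos hne hSfin
  have hcm (n : ℕ) : m ≤ c n := by
    have h1 : ∫ t in S, (1 : ℝ) ∂μ ≤ ∫ t in S, (1 / (t : ℝ)) ^ (n + 1) ∂μ := by
      refine setIntegral_mono_on (integrableOn_const hSfin) (hint n).integrableOn hSm fun t ht => ?_
      exact one_le_pow₀ (hone ht)
    refine le_trans (by simpa using h1) (setIntegral_le_integral (hint n) (ae_of_all _ fun t => ?_))
    have : 0 < (t : ℝ) := t.2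
    positivity
  set e : ℕ → FockSpace p q φ := fun n => ((‖(monomial hφ n : FockSpace p q φ)‖⁻¹ : ℝ) : ℂ) •
    monomial hφ n with he
  have henorm (n : ℕ) : ‖e n‖ = 1 := by
    have := norm_monomial_pos (p := p) (q := q) hφ n
    rw [he, norm_smul, Complex.norm_real, norm_inv, norm_norm, inv_mul_cancel₀ this.ne']
  have hTe (n : ℕ) : T (e n) = (c n : ℂ) • e n := by
    rw [he, map_smul, heigen, smul_comm]
  have hTe_norm (n : ℕ) : ‖T (e n)‖ = c n := by
    rw [hTe, norm_smul, henorm, mul_one, Complex.norm_real,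
      Real.norm_of_nonneg (hm0.le.trans (hcm n))]
  have hcT (n : ℕ) : c n ≤ ‖T‖ := by
    rw [← hTe_norm]
    simpa [henorm] using T.le_opNorm (e n)
  have hzero (z : ℂ) : Tendsto (fun n => T (e n) z) atTop (𝓝 0) := by
    have h1 := (summable_pow_div_norm_monomial (p := p) (q := q) hφ hz
      (norm_nonneg z)).tendsto_atTop_zero.const_mul ‖T‖
    rw [mul_zero] at h1
    refine squeeze_zero_norm (fun n => ?_) h1
    rw [hTe]
    change ‖(c n : ℂ) * (((‖(monomial hφ n : FockSpace p q φ)‖⁻¹ : ℝ) : ℂ) * z ^ n)‖ ≤ _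
    rw [norm_mul, norm_mul, Complex.norm_real, Complex.norm_real, norm_inv, norm_norm, norm_pow,
      Real.norm_of_nonneg (hm0.le.trans (hcm n)), div_eq_inv_mul]
    gcongr
    exact hcT n
  obtain ⟨K, hK, hTK⟩ := hTc.image_closedBall_subset_compact (𝕜₁ := ℂ) (f := T.toLinearMap) 1
  obtain ⟨y, -, ψ, hψ, hy⟩ := hK.tendsto_subseq (x := fun n => T (e n)) fun n =>
    hTK ⟨e n, by simp [henorm], rfl⟩
  have hy0 : y = 0 := by
    refine ext_apply fun z => ?_
    have h1 := ((eval hφ hz z).continuous.tendsto y).comp hy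
    exact tendsto_nhds_unique h1 ((hzero z).comp hψ.tendsto_atTop)
  have h2 : m ≤ ‖y‖ := ge_of_tendsto hy.norm (Eventually.of_forall fun n => by
    simpa only [Function.comp_apply, hTe_norm] using hcm (ψ n))
  rw [hy0, norm_zero] at h2
  linarith

/-- The defining integral of `H_μ 1` at `z = 0` is `∫ t⁻¹ dμ(t)`. -/
theorem lintegral_one_div_lt_top_of_isHausdorffOperator {p q : ℝ≥0∞} [hp : Fact (1 ≤ p)]
    [hq : Fact (1 ≤ q)] {φ : RadialWeight} (hφ : φ.InClassC) {μ : Measure (Ioi (0 : ℝ))}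
    {T : FockSpace p q φ →L[ℂ] FockSpace p q φ} (hT : IsHausdorffOperator μ T) :
    ∫⁻ t : Ioi (0 : ℝ), ENNReal.ofReal (1 / (t : ℝ)) ∂μ < ∞ := by
  have h := (hT (monomial hφ 0) 0).1.2
  rw [hasFiniteIntegral_iff_norm] at h
  convert! h using 4 with t
  have ht : 0 < (t : ℝ) := t.2
  simp [hausdorffKernel, monomial_apply, abs_of_pos ht]

end HausdorffFock

open HausdorffFock in
theorem theorem2p6 (p q : ℝ≥0∞) [Fact (1 ≤ p)] [Fact (1 ≤ q)] (φ : HausdorffFock.RadialWeight)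
    (hφ : φ.InClassC)
    (hz : Tendsto (fun n : ℕ => HausdorffFock.mixedNorm p q φ (fun z => z ^ n) ^ (1 / (n : ℝ)))
      atTop (𝓝 ∞))
    (μ : Measure (Ioi (0 : ℝ))) :
    (∃ T : HausdorffFock.FockSpace p q φ →L[ℂ] HausdorffFock.FockSpace p q φ,
      HausdorffFock.IsHausdorffOperator μ T ∧ IsCompactOperator T) ↔
    μ {t : Ioi (0 : ℝ) | (t : ℝ) ≤ 1} = 0 ∧
      ∫⁻ t : Ioi (0 : ℝ), ENNReal.ofReal (1 / (t : ℝ)) ∂μ < ∞ := by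
  constructor
  · rintro ⟨T, hT, hTc⟩
    exact ⟨measure_eq_zero_of_isCompactOperator hφ hz hT hTc,
      lintegral_one_div_lt_top_of_isHausdorffOperator hφ hT⟩
  · rintro ⟨h1, h2⟩
    refine exists_isCompactOperator_of_integrable hφ hz ?_ ?_
    · rw [ae_iff]
      simpa only [not_lt] using h1
    · refine ⟨(measurable_subtype_coe.const_div 1).aestronglyMeasurable, ?_⟩
      rw [hasFiniteIntegral_iff_norm]
      convert! h2 using 4 with t
      exact Real.norm_of_nonneg (one_div_nonneg.mpr t.2.out.le)
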